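/- **Setting.** Let $p,q\ge 1$ and let $\mathrm d\mu=(\mathrm d\mu_{b,a})$ be a $q\times p$ matrix of (complex) Borel measures on $\mathbb R$ with finite moments of all orders. Let $R(x)\in\mathbb C^{p\times p}[x]$ and $L(x)\in\mathbb C^{q\times q}[x]$ be regular matrix polynomials of degrees $N^R$, $N^L$, let $0\le r<p$, $0\le l<q$, and assume $$R_{N^R}=\begin{bmatrix}0_{(p-r)\times r}&I_{p-r}\\0_{r\times r}&0_{r\times(p-r)}\end{bmatrix},\quad R_{N^R-1}=\begin{bmatrix}*&*\\I_r&*\end{bmatrix},\qquad L_{N^L}=\begin{bmatrix}0_{l\times(q-l)}&0_{l}\\I_{q-l}&0_{(q-l)\times l}\end{bmatrix},\quad L_{N^L-1}=\begin{bmatrix}*&I_l\\ *&*\end{bmatrix}.$$ Assume that all zeros of $\det R$ and of $\det L$ are simple; let $\rho_1,\dots,\rho_{M^R}$ and $\lambda_1,\dots,\lambda_{M^L}$ be these zeros, listed without repetition. Let $\vec r_i$ and $\overleftarrow r_i$ be right and left eigenvectors of $R$ at $\rho_i$ (nonzero, $R(\rho_i)\vec r_i=0$, $\overleftarrow r_iR(\rho_i)=0$),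 and $\vec l_j$ right eigenvectors of $L$ at $\lambda_j$. For arbitrary column vector functions $\xi_i$ with $q$ entries, consider the Uvarov perturbation $$\mathrm d\tilde\mu(x)=L(x)\,\mathrm d\mu(x)\,R(x)^{-1}+\sum_{i=1}^{M^R}L(x)\,\xi_i(x)\,\overleftarrow r_i\,\delta(x-\rho_i),$$ understood as a matrix of linear functionals on polynomials. It is assumed that $L\,\mathrm d\mu\,R^{-1}$ is a well-defined matrix of measures with finite moments (in particular $\mu$ has no mass at real zeros of $\det R$) and that the integrals $\int \mathrm d\mu(x)\,\vec r_i/(\rho_i-x)$ converge absolutely. (Both are automatic if no $\rho_i$ lies in the support of $\mu$.) With $X_{[s]}(x)=[I_s;\,xI_s;\,x^2I_s;\dots]$, assume that the moment matrices $\mathscr M=\int X_{[q]}\,\mathrm d\mu\,X_{[p]}^\top$ and $\tilde{\mathscr M}=\int X_{[q]}\,\mathrm d\tilde\mu\,X_{[p]}^\top$ have Gauss–Borel factorizations $\mathscr M=S^{-1}H\bar S^{-\top}$, $\tilde{\mathscr M}=\tilde S^{-1}\tilde H\tilde{\bar S}^{-\top}$, where $S,\bar S,\tilde S,\tilde{\bar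 S}$ are lower unitriangular and $H,\tilde H$ are diagonal and invertible. Let $B_n(x)$, $n\ge 0$, be the rows of $B(x)=SX_{[q]}(x)$, and let $D_n(z)=\int B_n(x)\,\frac{\mathrm d\mu(x)}{z-x}$ be their Cauchy transforms; $D_n(\rho_i)\vec r_i$ denotes $\int B_n(x)\frac{\mathrm d\mu(x)}{\rho_i-x}\vec r_i$. The connection matrix is $\Omega=\tilde S\,L(\Lambda_{[q]})\,S^{-1}$, rows and columns indexed by $0,1,2,\dots$, where $L(\Lambda_{[q]})$ is the block upper triangular matrix whose $q\times q$ block $(I,J)$ is the coefficient $L_{J-I}$ of $x^{J-I}$ in $L(x)$. Put $$\mathbb B_k^{(j)}=B_k(\lambda_j)\vec l_j,\qquad \mathbb D_k^{(i)}=D_k(\rho_i)\vec r_i,\qquad \mathbb W_k^{(i)}=B_k(\rho_i)\,\xi_i(\rho_i)\;\overleftarrow r_i\,R'(\rho_i)\,\vec r_i .$$ **Claim.** Let $n\ge M^R$. The entries of row $n$ of $\Omega$ vanish outside the columns $n-M^R,\dots,n+M^L$, one has $\Omega_{n,n+M^L}=1$, and the remaining $M^R+M^L$ entries satisfy the square linear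 system $$\begin{bmatrix}\Omega_{n,n-M^R}&\cdots&\Omega_{n,n+M^L-1}\end{bmatrix} \begin{bmatrix}\mathbb B_{k}^{(1)}&\cdots&\mathbb B_{k}^{(M^L)}&\mathbb D_{k}^{(1)}-\mathbb W_{k}^{(1)}&\cdots&\mathbb D_{k}^{(M^R)}-\mathbb W_{k}^{(M^R)}\end{bmatrix}_{k=n-M^R,\dots,n+M^L-1}$$ $$=-\begin{bmatrix}\mathbb B_{n+M^L}^{(1)}&\cdots&\mathbb B_{n+M^L}^{(M^L)}&\mathbb D_{n+M^L}^{(1)}-\mathbb W_{n+M^L}^{(1)}&\cdots&\mathbb D_{n+M^L}^{(M^R)}-\mathbb W_{n+M^L}^{(M^R)}\end{bmatrix},$$ where the matrix on the left has one row for each $k$. -/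

import Mathlib

open MeasureTheory Polynomial

noncomputable section

namespace UvarovMOP

/-! ### Matrices of measures -/

/-- A `q × p` matrix of (finite, complex) Borel measures on the real line. -/
abbrev MeasureMatrix (q p : ℕ) := Fin q → Fin p → ComplexMeasure ℝ

/-- A finite positive measure dominating all entries of `μ`: the sum of the total variations of
the real and imaginary parts of the entries. -/
def domMeasure {q p : ℕ} (μ : MeasureMatrix q p) : Measure ℝ :=
  ∑ b, ∑ a, ((ComplexMeasure.re (μ b a)).totalVariation +
    (ComplexMeasure.im (μ b a)).totalVariation)

/-- The matrix of Radon–Nikodym densities `w` of `μ`, so that `dμ(x) = w(x) dm(x)` with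
`m = domMeasure μ`. -/
def density {q p : ℕ} (μ : MeasureMatrix q p) (x : ℝ) : Matrix (Fin q) (Fin p) ℂ :=
  Matrix.of fun b a =>
    (((ComplexMeasure.re (μ b a)).rnDeriv (domMeasure μ) x : ℝ) : ℂ) +
      Complex.I * (((ComplexMeasure.im (μ b a)).rnDeriv (domMeasure μ) x : ℝ) : ℂ)

/-- `dμ = w dm`: the matrix of measures is recovered from its density. -/
theorem setIntegral_density {q p : ℕ} (μ : MeasureMatrix q p) (b a) (s : Set ℝ) (hs : MeasurableSet s) :
   ∫ x in s, density μ x b a ∂(domMeasure μ) = μ b a s := by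
  have : IsFiniteMeasure (domMeasure μ) := by unfold domMeasure; infer_instance
  have hle : (ComplexMeasure.re (μ b a)).totalVariation +
    (ComplexMeasure.im (μ b a)).totalVariation ≤ domMeasure μ := by
    unfold domMeasure
    refine le_trans (Finset.single_le_sum (f := fun a => (ComplexMeasure.re (μ b a)).totalVariation +
    (ComplexMeasure.im (μ b a)).totalVariation) (fun _ _ => Measure.zero_le _) (Finset.mem_univ a)) ?_
    exact (Finset.single_le_sum (f := fun b => ∑ a, ((ComplexMeasure.re (μ b a)).totalVariation +
    (ComplexMeasure.im (μ b a)).totalVariation)) (fun _ _ => Measure.zero_le _) (Finset.mem_univ b))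
  have key : ∀ t : SignedMeasure ℝ, t.totalVariation ≤ domMeasure μ →
      ∫ x in s, t.rnDeriv (domMeasure μ) x ∂(domMeasure μ) = t s := by
    intro t ht
    have h1 : t ≪ᵥ (domMeasure μ).toENNRealVectorMeasure := by
      rw [SignedMeasure.absolutelyContinuous_ennreal_iff, (show (domMeasure μ).toENNRealVectorMeasure.ennrealToMeasure = domMeasure μ from VectorMeasure.equivMeasure.right_inv (domMeasure μ))]
      exact Measure.absolutelyContinuous_of_le ht
    have h2 := (SignedMeasure.absolutelyContinuous_iff_withDensityᵥ_rnDeriv_eq t (domMeasure μ)).1 h1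
    conv_rhs => rw [← h2]
    rw [withDensityᵥ_apply (SignedMeasure.integrable_rnDeriv _ _) hs]
  have hr := key _ (le_trans (Measure.le_add_right le_rfl) hle)
  have hi := key _ (le_trans (Measure.le_add_left le_rfl) hle)
  simp only [density, Matrix.of_apply]
  rw [integral_add, integral_const_mul, integral_complex_ofReal, integral_complex_ofReal, hr, hi]
  · apply Complex.ext <;> simp <;> rfl
  · exact ((SignedMeasure.integrable_rnDeriv _ _).integrableOn).ofReal
  · exact (((SignedMeasure.integrable_rnDeriv _ _).integrableOn).ofReal).const_mul _

/-- All moments of all entries of `μ` converge absolutely. -/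
def HasMoments {q p : ℕ} (μ : MeasureMatrix q p) : Prop :=
  ∀ (k : ℕ) (b : Fin q) (a : Fin p),
    Integrable (fun x : ℝ => (x : ℂ) ^ k * density μ x b a) (domMeasure μ)

/-! ### Matrix polynomials -/

/-- The value `P(z)` of a matrix polynomial. -/
def evalMat {m n : ℕ} (P : Matrix (Fin m) (Fin n) ℂ[X]) (z : ℂ) : Matrix (Fin m) (Fin n) ℂ :=
  P.map fun f => f.eval z

/-- The derivative `P'(z)` of a matrix polynomial. -/
def derivMat {m n : ℕ} (P : Matrix (Fin m) (Fin n) ℂ[X]) (z : ℂ) : Matrix (Fin m) (Fin n) ℂ :=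
  P.map fun f => (derivative f).eval z

/-- `R(x) = ∑_{k ≤ N} R_k x^k` with
`R_N = [[0_{(p-r)×r}, I_{p-r}], [0_{r×r}, 0_{r×(p-r)}]]`, and with the lower left `r × r` block
of `R_{N-1}` equal to the identity; the three other blocks of `R_{N-1}` are free. -/
structure RightNormalized {p : ℕ} (R : Matrix (Fin p) (Fin p) ℂ[X]) (N r : ℕ) : Prop where
  coeff_gt : ∀ k, N < k → ∀ a b, (R a b).coeff k = 0
  leading : ∀ a b : Fin p, (R a b).coeff N = if (b : ℕ) = a + r then 1 else 0
  subleading : ∀ k, k + 1 = N → ∀ a b : Fin p, p - r ≤ (a : ℕ) → (b : ℕ) < r →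
    (R a b).coeff k = if (a : ℕ) = (p - r) + b then 1 else 0

/-- `L(x) = ∑_{k ≤ N} L_k x^k` with
`L_N = [[0_{l×(q-l)}, 0_{l×l}], [I_{q-l}, 0_{(q-l)×l}]]`, and with the upper right `l × l` block
of `L_{N-1}` equal to the identity; the three other blocks of `L_{N-1}` are free. -/
structure LeftNormalized {q : ℕ} (L : Matrix (Fin q) (Fin q) ℂ[X]) (N l : ℕ) : Prop where
  coeff_gt : ∀ k, N < k → ∀ a b, (L a b).coeff k = 0
  leading : ∀ a b : Fin q, (L a b).coeff N = if (a : ℕ) = b + l then 1 else 0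
  subleading : ∀ k, k + 1 = N → ∀ a b : Fin q, (a : ℕ) < l → q - l ≤ (b : ℕ) →
    (L a b).coeff k = if (b : ℕ) = (q - l) + a then 1 else 0

/-- `P` is regular (`det P ≢ 0`), all zeros of `det P` are simple, and `ev` lists each of them
exactly once. -/
structure SimpleSpectrum {n M : ℕ} (P : Matrix (Fin n) (Fin n) ℂ[X]) (ev : Fin M → ℂ) :
    Prop where
  regular : P.det ≠ 0
  injective : Function.Injective ev
  isRoot_iff : ∀ z, P.det.IsRoot z ↔ ∃ i, ev i = z
  simple : ∀ i, P.det.rootMultiplicity (ev i) = 1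

/-- `v` is a right eigenvector of the matrix polynomial `P` at `z`. -/
def IsRightEigenvector {n : ℕ} (P : Matrix (Fin n) (Fin n) ℂ[X]) (z : ℂ) (v : Fin n → ℂ) :
    Prop :=
  v ≠ 0 ∧ Matrix.mulVec (evalMat P z) v = 0

/-- `v` is a left eigenvector of the matrix polynomial `P` at `z`. -/
def IsLeftEigenvector {n : ℕ} (P : Matrix (Fin n) (Fin n) ℂ[X]) (z : ℂ) (v : Fin n → ℂ) :
    Prop :=
  v ≠ 0 ∧ Matrix.vecMul v (evalMat P z) = 0

/-! ### Matrix functionals, moment matrices, perturbation -/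

/-- A `q × p` matrix of functionals on polynomials. -/
abbrev MatrixFunctional (q p : ℕ) := Fin q → Fin p → ℂ[X] → ℂ

/-- The matrix functional `f ↦ ∫ f(x) dμ(x)`. -/
def MeasureMatrix.functional {q p : ℕ} (μ : MeasureMatrix q p) : MatrixFunctional q p :=
  fun b a f => ∫ x : ℝ, f.eval (x : ℂ) * density μ x b a ∂(domMeasure μ)

/-- The density `L(x) w(x) R(x)⁻¹` of the matrix of measures `L(x) dμ(x) R(x)⁻¹` with respect to
`domMeasure μ`. -/
def perturbedDensity {q p : ℕ} (μ : MeasureMatrix q p) (L : Matrix (Fin q) (Fin q) ℂ[X])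
    (R : Matrix (Fin p) (Fin p) ℂ[X]) (x : ℝ) : Matrix (Fin q) (Fin p) ℂ :=
  evalMat L (x : ℂ) * density μ x * (evalMat R (x : ℂ))⁻¹

/-- `L(x) dμ(x) R(x)⁻¹` is a well-defined matrix of measures with finite moments: `μ` does not
charge the real zeros of `det R`, and `x ^ k L(x) w(x) R(x)⁻¹` is integrable for all `k`. -/
structure PerturbationDefined {q p : ℕ} (μ : MeasureMatrix q p)
    (L : Matrix (Fin q) (Fin q) ℂ[X]) (R : Matrix (Fin p) (Fin p) ℂ[X]) : Prop where
  noAtom : ∀ x : ℝ, R.det.IsRoot (x : ℂ) → domMeasure μ {x} = 0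
  integrable : ∀ (k : ℕ) (b : Fin q) (a : Fin p),
    Integrable (fun x : ℝ => (x : ℂ) ^ k * perturbedDensity μ L R x b a) (domMeasure μ)

/-- The Uvarov perturbation
`dμ̃(x) = L(x) dμ(x) R(x)⁻¹ + ∑ i, L(x) ξ_i(x) rl_i δ(x - ρ_i)`,
as a matrix of functionals on polynomials (the `ρ_i` may be complex). -/
def uvarovFunctional {q p M : ℕ} (μ : MeasureMatrix q p) (L : Matrix (Fin q) (Fin q) ℂ[X])
    (R : Matrix (Fin p) (Fin p) ℂ[X]) (ρ : Fin M → ℂ) (rl : Fin M → Fin p → ℂ)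
    (ξ : Fin M → ℂ → Fin q → ℂ) : MatrixFunctional q p :=
  fun b a f => (∫ x : ℝ, f.eval (x : ℂ) * perturbedDensity μ L R x b a ∂(domMeasure μ)) +
    ∑ i, f.eval (ρ i) * Matrix.mulVec (evalMat L (ρ i)) (ξ i (ρ i)) b * rl i a

/-- Entry `(i, b)` of the matrix of monomials `X_{[r]}(x) = [I_r; x I_r; x² I_r; …]`. -/
def monomials (r : ℕ) [NeZero r] (i : ℕ) (b : Fin r) : ℂ[X] :=
  if Fin.ofNat r i = b then X ^ (i / r) else 0

/-- The moment matrix `∫ X_{[q]}(x) dμ(x) X_{[p]}(x)ᵀ` of a matrix functional. -/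
def momentMatrix {q p : ℕ} [NeZero q] [NeZero p] (u : MatrixFunctional q p) : Matrix ℕ ℕ ℂ :=
  Matrix.of fun i j => u (Fin.ofNat q i) (Fin.ofNat p j) (X ^ (i / q) * X ^ (j / p))

/-! ### Semi-infinite matrices and the Gauss–Borel factorization -/

/-- Product of semi-infinite matrices (used only where all the sums involved are finite). -/
def imul (A B : Matrix ℕ ℕ ℂ) : Matrix ℕ ℕ ℂ := Matrix.of fun i j => ∑ᶠ k, A i k * B k j

/-- Lower unitriangular semi-infinite matrices. -/
def IsLowerUnitriangular (A : Matrix ℕ ℕ ℂ) : Prop :=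
  (∀ i, A i i = 1) ∧ ∀ i j, i < j → A i j = 0

/-- A Gauss–Borel factorization `𝓜 = S⁻¹ H S̄⁻ᵀ`, with `S`, `S̄` lower unitriangular and `H`
diagonal and invertible. The inverses are carried along, characterized as two-sided inverses
within the lower unitriangular matrices. -/
structure GaussBorel (𝓜 : Matrix ℕ ℕ ℂ) where
  S : Matrix ℕ ℕ ℂ
  Sinv : Matrix ℕ ℕ ℂ
  Sbar : Matrix ℕ ℕ ℂ
  SbarInv : Matrix ℕ ℕ ℂ
  H : ℕ → ℂ
  lower_S : IsLowerUnitriangular S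
  lower_Sinv : IsLowerUnitriangular Sinv
  lower_Sbar : IsLowerUnitriangular Sbar
  lower_SbarInv : IsLowerUnitriangular SbarInv
  S_mul_Sinv : imul S Sinv = 1
  Sinv_mul_S : imul Sinv S = 1
  Sbar_mul_SbarInv : imul Sbar SbarInv = 1
  SbarInv_mul_Sbar : imul SbarInv Sbar = 1
  H_ne_zero : ∀ n, H n ≠ 0
  factorization : 𝓜 = imul (imul Sinv (Matrix.diagonal H)) SbarInv.transpose

/-- The row vectors of polynomials `B_n = (B_n^{(1)}, …, B_n^{(q)})`: the rows of
`B(x) = S X_{[q]}(x)`. -/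
def GaussBorel.B {𝓜 : Matrix ℕ ℕ ℂ} (G : GaussBorel 𝓜) (q : ℕ) [NeZero q] (n : ℕ)
    (b : Fin q) : ℂ[X] :=
  ∑ i ∈ Finset.range (n + 1), C (G.S n i) * monomials q i b

/-- The row vector `B_n(z)`. -/
def GaussBorel.evalB {𝓜 : Matrix ℕ ℕ ℂ} (G : GaussBorel 𝓜) (q : ℕ) [NeZero q] (n : ℕ)
    (z : ℂ) : Fin q → ℂ :=
  fun b => (G.B q n b).eval z

/-- `L(Λ_{[q]}) = ∑ k, L_k Λ_{[q]}^k`: the block upper triangular matrix whose `q × q` block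
`(I, J)` is `L_{J - I}` for `I ≤ J` and `0` otherwise. -/
def polyShift {q : ℕ} [NeZero q] (L : Matrix (Fin q) (Fin q) ℂ[X]) : Matrix ℕ ℕ ℂ :=
  Matrix.of fun i j =>
    if i / q ≤ j / q then (L (Fin.ofNat q i) (Fin.ofNat q j)).coeff (j / q - i / q) else 0

/-- The connection matrix `Ω = S̃ L(Λ_{[q]}) S⁻¹`. -/
def connectionMatrix {q : ℕ} [NeZero q] {𝓜 𝓜t : Matrix ℕ ℕ ℂ} (G : GaussBorel 𝓜)
    (Gt : GaussBorel 𝓜t) (L : Matrix (Fin q) (Fin q) ℂ[X]) : Matrix ℕ ℕ ℂ :=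
  imul (imul Gt.S (polyShift L)) G.Sinv

/-! ### Cauchy transforms and the entries of the linear system -/

/-- The Cauchy transform `D_n(z) = ∫ B_n(x) dμ(x) / (z - x)`, a row vector with `p` entries. -/
def cauchyD {q p : ℕ} [NeZero q] {𝓜 : Matrix ℕ ℕ ℂ} (μ : MeasureMatrix q p) (G : GaussBorel 𝓜)
    (n : ℕ) (z : ℂ) : Fin p → ℂ :=
  fun a => ∫ x : ℝ, Matrix.vecMul (G.evalB q n x) (density μ x) a / (z - x) ∂(domMeasure μ)

/-- `D_n(z) v = ∫ B_n(x) dμ(x) v / (z - x)` for a column vector `v`; it agrees with `cauchyD`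
whenever all the entries of `D_n(z)` converge (see `cauchyD_dotProduct`), but only requires the
convergence of the combination of them that is actually used. -/
def cauchyDApply {q p : ℕ} [NeZero q] {𝓜 : Matrix ℕ ℕ ℂ} (μ : MeasureMatrix q p)
    (G : GaussBorel 𝓜) (n : ℕ) (z : ℂ) (v : Fin p → ℂ) : ℂ :=
  ∫ x : ℝ, (G.evalB q n x ⬝ᵥ Matrix.mulVec (density μ x) v) / (z - x) ∂(domMeasure μ)

theorem cauchyD_dotProduct {q p : ℕ} [NeZero q] {𝓜 : Matrix ℕ ℕ ℂ} (μ : MeasureMatrix q p)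
    (G : GaussBorel 𝓜) (n : ℕ) (z : ℂ) (v : Fin p → ℂ)
    (h : ∀ a, Integrable
      (fun x : ℝ => Matrix.vecMul (G.evalB q n x) (density μ x) a / (z - x)) (domMeasure μ)) :
    cauchyD μ G n z ⬝ᵥ v = cauchyDApply μ G n z v := by
  simp only [cauchyD, cauchyDApply, dotProduct]
  simp_rw [← integral_mul_const]
  rw [← integral_finsetSum _ fun a _ => (h a).mul_const _]
  refine integral_congr_ae (Filter.Eventually.of_forall fun x => ?_)
  have := Matrix.dotProduct_mulVec (G.evalB q n x) (density μ x) v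
  simp only [dotProduct] at this
  simp only [this, Finset.sum_div]
  exact Finset.sum_congr rfl fun a _ => by ring

/-- Absolute convergence of the integrals `∫ dμ(x) v / (z - x)`, and hence of `D_n(z) v` for
all `n`. -/
def CauchyDefined {q p : ℕ} (μ : MeasureMatrix q p) (z : ℂ) (v : Fin p → ℂ) : Prop :=
  ∀ b, Integrable (fun x : ℝ => Matrix.mulVec (density μ x) v b / (z - x)) (domMeasure μ)

/-- The row with index `k` of the linear system: first `B_k(λ_j) lr_j`, `1 ≤ j ≤ M^L`, then
`D_k(ρ_i) rr_i - W_k^{(i)}`, `1 ≤ i ≤ M^R`, where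
`W_k^{(i)} = B_k(ρ_i) ξ_i(ρ_i) · rl_i R'(ρ_i) rr_i`. -/
def systemRow {q p ML MR : ℕ} [NeZero q] {𝓜 : Matrix ℕ ℕ ℂ} (μ : MeasureMatrix q p)
    (G : GaussBorel 𝓜) (R : Matrix (Fin p) (Fin p) ℂ[X])
    (lam : Fin ML → ℂ) (lr : Fin ML → Fin q → ℂ)
    (ρ : Fin MR → ℂ) (rl rr : Fin MR → Fin p → ℂ) (ξ : Fin MR → ℂ → Fin q → ℂ)
    (k : ℕ) : Fin ML ⊕ Fin MR → ℂ :=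
  Sum.elim
    (fun j => G.evalB q k (lam j) ⬝ᵥ lr j)
    (fun i => cauchyDApply μ G k (ρ i) (rr i) -
      (G.evalB q k (ρ i) ⬝ᵥ ξ i (ρ i)) * (rl i ⬝ᵥ Matrix.mulVec (derivMat R (ρ i)) (rr i)))

end UvarovMOP

end

noncomputable section

namespace UvarovMOP

/-! ### Normalized matrix polynomials -/

/-! Two identities carry the proof: the connection formula `B̃ L = Ω B`, immediate from `Ω = S̃ L(Λ)
S⁻¹`, and `dμ̃ R = L dμ`, in which the point masses disappear because their row factors are left
eigenvectors of `R`.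

Band structure. Order the vector monomials `x^k e_b` by the index `q k + b`. The normalization of
`L` says that `L(Λ)` has exactly `q N - l` superdiagonals, the last one filled with ones, and a
determinant computation (`LeftNormalized.natDegree_det`) identifies `q N - l` with the number of
zeros of `det L`. As `S̃` and `S⁻¹` are lower unitriangular, `Ω` inherits its upper edge from
`L(Λ)`. The lower edge comes from orthogonality: `B̃_n` annihilates `R x_k` as soon as `k + M^R <
n`, where `x_k` is the `k`-th column monomial (`connectionMatrix_eq_zero_of_add_lt`).

Linear system. At `λ_j`, applying `B̃ L = Ω B` to a right eigenvector of `L` gives zero. At `ρ_i`,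
pair `B̃_n` with the polynomial vector `Q_i = R(x) r_i / (x - ρ_i)`. It involves only the first
`M^R` monomials, so the pairing is zero for `n ≥ M^R`; computed directly, it is `-∑ Ω_{n,k}
(D_k(ρ_i) r_i - W_k^{(i)})` (`pairing_eigenQuotient`). -/

/-- Since `d = q N - l`, index `a + d` is exactly where the prescribed ones of row `a` sit, in `L_N`
or in `L_{N-1}`. Coefficients with `k ≤ N - 2` never reach that index. -/
theorem LeftNormalized.coeff_eq_zero {q N l d : ℕ} {L : Matrix (Fin q) (Fin q) ℂ[X]}
    (hL : LeftNormalized L N l) (hl : l < q) (hd : d + l = q * N) (a b : Fin q) (k : ℕ)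
    (h : a + d < q * k + b) : (L a b).coeff k = 0 := by
  have ha := a.2
  have hb := b.2
  rcases lt_trichotomy N k with hk | hk | hk
  · exact hL.coeff_gt k hk a b
  · subst hk
    rw [hL.leading, if_neg (by omega)]
  · rcases Nat.eq_or_lt_of_le (Nat.succ_le_of_lt hk) with hk' | hk'
    · subst hk'
      rw [Nat.succ_eq_add_one, mul_add] at hd
      rw [hL.subleading k rfl a b (by omega) (by omega), if_neg (by omega)]
    · obtain ⟨t, rfl⟩ := Nat.exists_eq_add_of_le (Nat.succ_le_of_lt hk')
      have : q * (k + 1 + 1 + t) = q * k + q + q + q * t := by ring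
      simp only [Nat.succ_eq_add_one] at hd
      omega

theorem LeftNormalized.coeff_eq_one {q N l d : ℕ} {L : Matrix (Fin q) (Fin q) ℂ[X]}
    (hL : LeftNormalized L N l) (hl : l < q) (hd : d + l = q * N) (a b : Fin q) (k : ℕ)
    (h : q * k + b = a + d) : (L a b).coeff k = 1 := by
  have ha := a.2
  have hb := b.2
  rcases lt_trichotomy N k with hk | hk | hk
  · obtain ⟨t, rfl⟩ := Nat.exists_eq_add_of_le (Nat.succ_le_of_lt hk)
    have : q * (N + 1 + t) = q * N + q + q * t := by ring
    simp only [Nat.succ_eq_add_one] at h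
    omega
  · subst hk
    rw [hL.leading, if_pos (by omega)]
  · rcases Nat.eq_or_lt_of_le (Nat.succ_le_of_lt hk) with hk' | hk'
    · subst hk'
      rw [Nat.succ_eq_add_one, mul_add] at hd
      rw [hL.subleading k rfl a b (by omega) (by omega), if_pos (by omega)]
    · obtain ⟨t, rfl⟩ := Nat.exists_eq_add_of_le (Nat.succ_le_of_lt hk')
      have : q * (k + 1 + 1 + t) = q * k + q + q + q * t := by ring
      simp only [Nat.succ_eq_add_one] at hd
      omega

theorem RightNormalized.transpose {p N r : ℕ} {R : Matrix (Fin p) (Fin p) ℂ[X]}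
    (hR : RightNormalized R N r) : LeftNormalized R.transpose N r where
  coeff_gt k hk a b := hR.coeff_gt k hk b a
  leading a b := hR.leading b a
  subleading k hk a b ha hb := hR.subleading k hk b a hb ha

/-- If all entries of `A` have degree at most `d`, the coefficient of `X ^ (n d)` in `det A` is
the determinant of the matrix of coefficients of `X ^ d`. -/
theorem coeff_det_of_natDegree_le {n d : ℕ} (A : Matrix (Fin n) (Fin n) ℂ[X])
    (h : ∀ a b, (A a b).natDegree ≤ d) :
    A.det.natDegree ≤ n * d ∧
      A.det.coeff (n * d) = (Matrix.of fun a b => (A a b).coeff d).det := by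
  constructor
  · rw [Matrix.det_apply]
    refine natDegree_sum_le_of_forall_le _ _ fun σ _ => ?_
    refine (natDegree_smul_le _ _).trans ((natDegree_prod_le _ _).trans ?_)
    refine (Finset.sum_le_card_nsmul _ _ d fun i _ => h _ _).trans ?_
    simp
  · rw [Matrix.det_apply, Matrix.det_apply, finsetSum_coeff]
    refine Finset.sum_congr rfl fun σ _ => ?_
    rw [coeff_smul]
    congr 1
    have := coeff_prod_of_natDegree_le (s := Finset.univ) (fun i => A (σ i) i) d
      (fun i _ => h _ _)
    simpa using this

/-- The leading matrix of `L` may be singular, so the degree cannot be read off directly.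
Substituting `x ↦ x^q` and weighting the entries turns the flattened order into an ordinary degree,
for which the leading matrix is a permutation matrix. -/
theorem LeftNormalized.natDegree_det {q N l d : ℕ} {L : Matrix (Fin q) (Fin q) ℂ[X]}
    (hL : LeftNormalized L N l) (hl : l < q) (hd : d + l = q * N) :
    L.det.natDegree = d := by
  have hq : 0 < q := by omega
  have : NeZero q := ⟨by omega⟩
  -- The weight `x^(b - a)` encodes the index shift; the extra `q - 1` keeps exponents nonnegative.
  let A : Matrix (Fin q) (Fin q) ℂ[X] :=
    Matrix.of fun a b => X ^ (q - 1 - a : ℕ) * (X ^ (b : ℕ) * expand ℂ q (L a b))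
  have hA : A = Matrix.of fun a b : Fin q => X ^ (q - 1 - a : ℕ) *
      (Matrix.of fun a b : Fin q => X ^ (b : ℕ) * ((expand ℂ q).toRingHom.mapMatrix L) a b) a b := rfl
  have hcoeff : ∀ a b m, (A a b).coeff m = if (q - 1 - a) + b ≤ m ∧ q ∣ m - ((q - 1 - a) + b)
      then (L a b).coeff ((m - ((q - 1 - a) + b)) / q) else 0 := by
    intro a b m
    simp only [A, Matrix.of_apply]
    rw [← mul_assoc, ← pow_add, coeff_X_pow_mul']
    split_ifs with h1 h2 h2
    · rw [coeff_expand hq, if_pos h2.2]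
    · rw [coeff_expand hq, if_neg (by tauto)]
    · tauto
    · rfl
  have hdeg : ∀ a b, (A a b).natDegree ≤ d + (q - 1) := by
    intro a b
    refine natDegree_le_iff_coeff_eq_zero.2 fun m hm => ?_
    rw [hcoeff]
    split_ifs with h
    · obtain ⟨h1, k, hk⟩ := h
      have ha := a.2
      rw [hk, Nat.mul_div_cancel_left _ hq]
      exact hL.coeff_eq_zero hl hd a b k (by omega)
    · rfl
  obtain ⟨h1, h2⟩ := coeff_det_of_natDegree_le A hdeg
  -- Row `a` reaches the top degree only in the column `b ≡ a + d` modulo `q`, with coefficient 1.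
  have hP : (Matrix.of fun a b => (A a b).coeff (d + (q - 1))) =
      (Equiv.addRight (Fin.ofNat q d)).permMatrix ℂ := by
    ext a b
    have ha := a.2
    have hb := b.2
    rw [Matrix.of_apply, hcoeff, Equiv.Perm.permMatrix, PEquiv.toMatrix_apply]
    simp only [Equiv.toPEquiv_apply, Equiv.coe_addRight, Option.mem_def, Option.some.injEq]
    have key : (a + Fin.ofNat q d = b) ↔ (a + d) % q = b := by
      rw [Fin.ext_iff, Fin.val_add]; simp
    simp only [key]
    by_cases h : (a + d) % q = b
    · have e := Nat.div_add_mod (a + d) q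
      rw [h] at e
      have e2 : d + (q - 1) - ((q - 1 - a) + b) = q * ((a + d) / q) := by omega
      rw [if_pos h, if_pos ⟨by omega, by rw [e2]; exact dvd_mul_right _ _⟩, e2,
        Nat.mul_div_cancel_left _ hq]
      exact hL.coeff_eq_one hl hd a b _ (by omega)
    · rw [if_neg h, if_neg]
      rintro ⟨h3, k, hk⟩
      apply h
      have : (a : ℕ) + d = b + q * k := by omega
      rw [this, Nat.add_mul_mod_self_left, Nat.mod_eq_of_lt hb]
  have hdet : A.det = X ^ (∑ a : Fin q, (q - 1 - a : ℕ)) *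
      (X ^ (∑ a : Fin q, (a : ℕ)) * expand ℂ q L.det) := by
    rw [hA, Matrix.det_mul_column, Matrix.det_mul_row, ← RingHom.map_det,
      Finset.prod_pow_eq_pow_sum, Finset.prod_pow_eq_pow_sum]
    rfl
  have hne : A.det.coeff (q * (d + (q - 1))) ≠ 0 := by
    rw [h2, hP, Matrix.det_permutation]
    have := Units.ne_zero (Equiv.Perm.sign (Equiv.addRight (Fin.ofNat q d)))
    exact_mod_cast this
  have hnd : A.det.natDegree = q * (d + (q - 1)) := le_antisymm h1 (le_natDegree_of_ne_zero hne)
  have hL0 : L.det ≠ 0 := by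
    rintro h0
    rw [hdet, h0] at hne
    simp at hne
  rw [hdet, ← mul_assoc, ← pow_add, ← Finset.sum_add_distrib, natDegree_mul (by simp)
    ((expand_ne_zero hq).2 hL0), natDegree_X_pow, natDegree_expand,
    Finset.sum_congr rfl (fun (a : Fin q) _ => show (q - 1 - (a : ℕ) + (a : ℕ)) = q - 1 by omega)] at hnd
  simp only [Finset.sum_const, Finset.card_univ, Fintype.card_fin, smul_eq_mul] at hnd
  have : q * L.det.natDegree = q * d := by
    rw [mul_add] at hnd
    rw [mul_comm q L.det.natDegree]
    omega
  exact Nat.eq_of_mul_eq_mul_left hq this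

theorem SimpleSpectrum.natDegree_det {n M : ℕ} {P : Matrix (Fin n) (Fin n) ℂ[X]} {ev : Fin M → ℂ}
    (h : SimpleSpectrum P ev) : P.det.natDegree = M := by
  have hmem : ∀ z, z ∈ P.det.roots ↔ ∃ i, ev i = z := fun z => by
    rw [mem_roots h.regular, h.isRoot_iff]
  have hroots : P.det.roots = (Finset.univ.image ev).val := by
    ext z
    by_cases hz : ∃ i, ev i = z
    · obtain ⟨i, rfl⟩ := hz
      rw [count_roots, h.simple, Multiset.count_eq_one_of_mem (Finset.nodup _) (by simp)]
    · rw [Multiset.count_eq_zero_of_notMem (by rwa [hmem]), Multiset.count_eq_zero_of_notMem]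
      simpa using hz
  rw [← (IsAlgClosed.card_roots_eq_natDegree (p := P.det)), hroots, Finset.card_val,
    Finset.card_image_of_injective _ h.injective]
  simp

theorem LeftNormalized.add_eq_mul {q N l M : ℕ} {L : Matrix (Fin q) (Fin q) ℂ[X]}
    {ev : Fin M → ℂ} (hL : LeftNormalized L N l) (hl : l < q) (h : SimpleSpectrum L ev) :
    M + l = q * N := by
  -- This makes `q N - l` a true difference. For `N = 0` and `l > 0` the first row of `L` would
  -- vanish, against regularity.
  have hle : l ≤ q * N := by
    rcases Nat.eq_zero_or_pos N with hN | hN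
    · subst hN
      by_contra hl0
      refine h.regular (Matrix.det_eq_zero_of_row_eq_zero ⟨0, by omega⟩ fun b => ?_)
      ext k
      rcases Nat.eq_zero_or_pos k with hk | hk
      · subst hk
        rw [hL.leading, if_neg (by simp; omega), coeff_zero]
      · rw [hL.coeff_gt k hk, coeff_zero]
    · nlinarith
  obtain ⟨d, hd⟩ := Nat.exists_eq_add_of_le hle
  have := hL.natDegree_det hl (d := d) (by omega)
  rw [h.natDegree_det] at this
  omega

/-! ### Row vectors of polynomials and the shift matrix -/

theorem sum_monomials {q : ℕ} [NeZero q] (v : Fin q → ℂ[X]) (N : ℕ)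
    (h : ∀ (b : Fin q) k, N ≤ q * k + b → (v b).coeff k = 0) :
    v = ∑ m ∈ Finset.range N, (v (Fin.ofNat q m)).coeff (m / q) • monomials q m := by
  have hq : 0 < q := NeZero.pos q
  ext b k
  have hb := b.2
  rw [Finset.sum_apply, finsetSum_coeff]
  have hdiv : (q * k + b) / q = k := by
    rw [Nat.mul_add_div hq, Nat.div_eq_of_lt hb, add_zero]
  have hmod : Fin.ofNat q (q * k + b) = b := by
    ext
    simp [Nat.mod_eq_of_lt hb]
  rw [Finset.sum_eq_single (q * k + b)]
  · simp only [Pi.smul_apply, coeff_smul, monomials, hdiv, hmod, if_true, coeff_X_pow, smul_eq_mul,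
      mul_one]
  · intro m _ hm
    simp only [Pi.smul_apply, monomials, coeff_smul]
    split_ifs with hmb
    · rw [coeff_X_pow, if_neg, smul_zero]
      rintro rfl
      apply hm
      rw [← hmb, Fin.val_ofNat, Nat.div_add_mod]
    · simp
  · intro hm
    rw [Pi.smul_apply, coeff_smul, hdiv, hmod, h b k (by simpa using hm), zero_smul]

theorem vecMul_monomials {q : ℕ} [NeZero q] (L : Matrix (Fin q) (Fin q) ℂ[X]) (i : ℕ) (b : Fin q) :
    Matrix.vecMul (monomials q i) L b = X ^ (i / q) * L (Fin.ofNat q i) b := by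
  simp [Matrix.vecMul, dotProduct, monomials]

theorem polyShift_eq_coeff {q : ℕ} [NeZero q] (L : Matrix (Fin q) (Fin q) ℂ[X]) (i m : ℕ) :
    polyShift L i m = (Matrix.vecMul (monomials q i) L (Fin.ofNat q m)).coeff (m / q) := by
  rw [vecMul_monomials, coeff_X_pow_mul']
  rfl

theorem LeftNormalized.polyShift_eq_zero {q N l d : ℕ} [NeZero q] {L : Matrix (Fin q) (Fin q) ℂ[X]}
    (hL : LeftNormalized L N l) (hl : l < q) (hd : d + l = q * N) {i m : ℕ} (h : i + d < m) :
    polyShift L i m = 0 := by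
  simp only [polyShift, Matrix.of_apply]
  split_ifs with him
  · apply hL.coeff_eq_zero hl hd
    rw [Nat.mul_sub]
    have := Nat.div_add_mod i q
    have := Nat.div_add_mod m q
    have := Nat.mul_le_mul_left q him
    simp only [Fin.val_ofNat]
    omega
  · rfl

theorem LeftNormalized.polyShift_eq_one {q N l d : ℕ} [NeZero q] {L : Matrix (Fin q) (Fin q) ℂ[X]}
    (hL : LeftNormalized L N l) (hl : l < q) (hd : d + l = q * N) (i : ℕ) :
    polyShift L i (i + d) = 1 := by
  have him : i / q ≤ (i + d) / q := Nat.div_le_div_right (by omega)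
  simp only [polyShift, Matrix.of_apply]
  rw [if_pos him]
  apply hL.coeff_eq_one hl hd
  rw [Nat.mul_sub]
  have := Nat.div_add_mod i q
  have := Nat.div_add_mod (i + d) q
  have := Nat.mul_le_mul_left q him
  simp only [Fin.val_ofNat]
  omega

/-- Row `i` of `X_{[q]} L = L(Λ) X_{[q]}`. The free bound `K` lets several rows share one
truncation. -/
theorem LeftNormalized.vecMul_monomials_eq_sum {q N l d : ℕ} [NeZero q]
    {L : Matrix (Fin q) (Fin q) ℂ[X]} (hL : LeftNormalized L N l) (hl : l < q)
    (hd : d + l = q * N) (i : ℕ) {K : ℕ} (hK : i + d < K) :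
    Matrix.vecMul (monomials q i) L =
      ∑ m ∈ Finset.range K, polyShift L i m • monomials q m := by
  simp_rw [polyShift_eq_coeff]
  refine sum_monomials _ K fun b k hk => ?_
  rw [← hL.polyShift_eq_zero hl hd (lt_of_lt_of_le hK hk), polyShift_eq_coeff]
  have hdiv : (q * k + b) / q = k := by
    rw [Nat.mul_add_div (NeZero.pos q), Nat.div_eq_of_lt b.2, add_zero]
  have hmod : Fin.ofNat q (q * k + b) = b := by
    ext
    simp [Nat.mod_eq_of_lt b.2]
  rw [hdiv, hmod]

/-! ### Semi-infinite matrices -/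

theorem imul_apply_eq_sum {A B : Matrix ℕ ℕ ℂ} {i j N : ℕ} (h : ∀ k, N ≤ k → A i k = 0) :
    imul A B i j = ∑ k ∈ Finset.range N, A i k * B k j := by
  refine finsum_eq_sum_of_support_subset _ fun k hk => ?_
  by_contra hkN
  exact hk (by simp only [h k (by simpa using hkN), zero_mul])

/-! ### Gauss–Borel factorization and the connection formula -/

section GaussBorel

variable {𝓜 𝓜t : Matrix ℕ ℕ ℂ} (G : GaussBorel 𝓜) (Gt : GaussBorel 𝓜t) {q : ℕ} [NeZero q]

theorem GaussBorel.B_eq_sum (n : ℕ) {K : ℕ} (hK : n < K) :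
    G.B q n = ∑ i ∈ Finset.range K, G.S n i • monomials q i := by
  rw [← Finset.sum_subset (Finset.range_mono (Nat.succ_le_of_lt hK))]
  · ext1 b
    simp [GaussBorel.B, smul_eq_C_mul]
  · intro i _ hi
    rw [G.lower_S.2 n i (by simpa using hi), zero_smul]

theorem GaussBorel.sum_Sinv_mul_S (i j : ℕ) {K : ℕ} (hK : i < K) :
    ∑ k ∈ Finset.range K, G.Sinv i k * G.S k j = if i = j then 1 else 0 := by
  rw [← imul_apply_eq_sum fun k hk => G.lower_Sinv.2 i k (lt_of_lt_of_le hK hk), G.Sinv_mul_S,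
    Matrix.one_apply]

theorem GaussBorel.sum_S_mul_Sinv (i j : ℕ) {K : ℕ} (hK : i < K) :
    ∑ k ∈ Finset.range K, G.S i k * G.Sinv k j = if i = j then 1 else 0 := by
  rw [← imul_apply_eq_sum fun k hk => G.lower_S.2 i k (lt_of_lt_of_le hK hk), G.S_mul_Sinv,
    Matrix.one_apply]

theorem GaussBorel.monomials_eq_sum (m : ℕ) {K : ℕ} (hK : m < K) :
    monomials q m = ∑ k ∈ Finset.range K, G.Sinv m k • G.B q k := by
  have : ∀ k ∈ Finset.range K, G.Sinv m k • G.B q k =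
      ∑ i ∈ Finset.range K, (G.Sinv m k * G.S k i) • monomials q i := fun k hk => by
    rw [G.B_eq_sum k (Finset.mem_range.1 hk), Finset.smul_sum]
    simp_rw [smul_smul]
  rw [Finset.sum_congr rfl this, Finset.sum_comm]
  simp_rw [← Finset.sum_smul, G.sum_Sinv_mul_S m _ hK]
  simp [hK]

/-- `S 𝓜 = H S̄⁻ᵀ`. -/
theorem GaussBorel.sum_S_mul_moment (n j : ℕ) :
    ∑ i ∈ Finset.range (n + 1), G.S n i * 𝓜 i j = G.H n * G.SbarInv j n := by
  have hM : ∀ i ∈ Finset.range (n + 1), G.S n i * 𝓜 i j =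
      ∑ k ∈ Finset.range (n + 1), G.S n i * G.Sinv i k * (G.H k * G.SbarInv j k) := by
    intro i hi
    have h1 : ∀ k, imul G.Sinv (Matrix.diagonal G.H) i k = G.Sinv i k * G.H k := by
      intro k
      rw [imul_apply_eq_sum (N := i + k + 1) fun k' hk' => G.lower_Sinv.2 i k' (by omega),
        Finset.sum_eq_single k]
      · simp
      · intro k' _ hk'
        simp [Matrix.diagonal_apply_ne _ hk']
      · simp
    have h2 : 𝓜 i j = imul (imul G.Sinv (Matrix.diagonal G.H)) G.SbarInv.transpose i j :=
      congrFun (congrFun G.factorization i) j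
    rw [h2, imul_apply_eq_sum (N := n + 1), Finset.mul_sum]
    · simp_rw [h1, Matrix.transpose_apply]
      exact Finset.sum_congr rfl fun k _ => by ring
    · intro k hk
      rw [h1, G.lower_Sinv.2 i k (by simp at hi; omega), zero_mul]
  rw [Finset.sum_congr rfl hM, Finset.sum_comm]
  simp_rw [← Finset.sum_mul, G.sum_S_mul_Sinv n _ (Nat.lt_succ_self n)]
  simp

variable {L : Matrix (Fin q) (Fin q) ℂ[X]} {N l d : ℕ}

theorem LeftNormalized.imul_S_polyShift (hL : LeftNormalized L N l) (hl : l < q)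
    (hd : d + l = q * N) {n k : ℕ} (hk : n + d < k) : imul Gt.S (polyShift L) n k = 0 := by
  rw [imul_apply_eq_sum (N := n + 1) fun k hk => Gt.lower_S.2 n k hk]
  refine Finset.sum_eq_zero fun i hi => ?_
  rw [hL.polyShift_eq_zero hl hd (by simp at hi; omega), mul_zero]

theorem LeftNormalized.connectionMatrix_apply (hL : LeftNormalized L N l) (hl : l < q)
    (hd : d + l = q * N) (n k : ℕ) : connectionMatrix G Gt L n k =
      ∑ m ∈ Finset.range (n + d + 1), imul Gt.S (polyShift L) n m * G.Sinv m k :=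
  imul_apply_eq_sum fun _ hm => hL.imul_S_polyShift Gt hl hd hm

theorem LeftNormalized.connectionMatrix_eq_zero (hL : LeftNormalized L N l) (hl : l < q)
    (hd : d + l = q * N) {n k : ℕ} (hk : n + d < k) : connectionMatrix G Gt L n k = 0 := by
  rw [hL.connectionMatrix_apply G Gt hl hd]
  refine Finset.sum_eq_zero fun m hm => ?_
  rw [G.lower_Sinv.2 m k (by simp at hm; omega), mul_zero]

/-- One product survives: the diagonal of `S̃`, the outermost superdiagonal of `L(Λ)` and the
diagonal of `S⁻¹`, all ones. -/
theorem LeftNormalized.connectionMatrix_eq_one (hL : LeftNormalized L N l) (hl : l < q)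
    (hd : d + l = q * N) (n : ℕ) : connectionMatrix G Gt L n (n + d) = 1 := by
  rw [hL.connectionMatrix_apply G Gt hl hd, Finset.sum_range_succ, Finset.sum_eq_zero, zero_add,
    G.lower_Sinv.1, mul_one, imul_apply_eq_sum (N := n + 1) fun k hk => Gt.lower_S.2 n k hk,
    Finset.sum_range_succ, Finset.sum_eq_zero, zero_add, Gt.lower_S.1, one_mul,
    hL.polyShift_eq_one hl hd]
  · intro i hi
    rw [hL.polyShift_eq_zero hl hd (by simp at hi; omega), mul_zero]
  · intro m hm
    rw [G.lower_Sinv.2 m _ (by simpa using hm), mul_zero]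

/-- The connection formula `B̃ L = Ω B`. -/
theorem LeftNormalized.vecMul_B (hL : LeftNormalized L N l) (hl : l < q) (hd : d + l = q * N)
    (n : ℕ) : Matrix.vecMul (Gt.B q n) L =
      ∑ k ∈ Finset.range (n + d + 1), connectionMatrix G Gt L n k • G.B q k := by
  have h1 : Matrix.vecMul (Gt.B q n) L =
      ∑ m ∈ Finset.range (n + d + 1), imul Gt.S (polyShift L) n m • monomials q m := by
    rw [Gt.B_eq_sum n (Nat.lt_succ_self n), Matrix.sum_vecMul]
    have : ∀ i ∈ Finset.range (n + 1), Matrix.vecMul (Gt.S n i • monomials q i) L =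
        ∑ m ∈ Finset.range (n + d + 1), (Gt.S n i * polyShift L i m) • monomials q m := by
      intro i hi
      rw [Matrix.smul_vecMul, hL.vecMul_monomials_eq_sum hl hd i (K := n + d + 1)
        (by simp at hi; omega), Finset.smul_sum]
      simp_rw [smul_smul]
    rw [Finset.sum_congr rfl this, Finset.sum_comm]
    refine Finset.sum_congr rfl fun m _ => ?_
    rw [imul_apply_eq_sum (N := n + 1) fun k hk => Gt.lower_S.2 n k hk, Finset.sum_smul]
  have h2 : ∀ m ∈ Finset.range (n + d + 1), imul Gt.S (polyShift L) n m • monomials q m =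
      ∑ k ∈ Finset.range (n + d + 1),
        (imul Gt.S (polyShift L) n m * G.Sinv m k) • G.B q k := by
    intro m hm
    rw [G.monomials_eq_sum m (Finset.mem_range.1 hm), Finset.smul_sum]
    simp_rw [smul_smul]
  rw [h1, Finset.sum_congr rfl h2, Finset.sum_comm]
  refine Finset.sum_congr rfl fun k _ => ?_
  rw [hL.connectionMatrix_apply G Gt hl hd, Finset.sum_smul]

end GaussBorel

/-! ### The bilinear pairing of a matrix functional -/

/-- The value of a vector of polynomials. -/
def evalVec {n : ℕ} (v : Fin n → ℂ[X]) (z : ℂ) : Fin n → ℂ := fun b => (v b).eval z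

theorem evalVec_vecMul {m n : ℕ} (v : Fin m → ℂ[X]) (P : Matrix (Fin m) (Fin n) ℂ[X]) (z : ℂ) :
    evalVec (Matrix.vecMul v P) z = Matrix.vecMul (evalVec v z) (evalMat P z) := by
  ext b
  simp [evalVec, evalMat, Matrix.vecMul, dotProduct, eval_finsetSum]

theorem evalVec_mulVec {m n : ℕ} (P : Matrix (Fin m) (Fin n) ℂ[X]) (w : Fin n → ℂ[X]) (z : ℂ) :
    evalVec (Matrix.mulVec P w) z = Matrix.mulVec (evalMat P z) (evalVec w z) := by
  ext b
  simp [evalVec, evalMat, Matrix.mulVec, dotProduct, eval_finsetSum]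

theorem evalVec_sum_smul {n : ℕ} {ι : Type*} (s : Finset ι) (c : ι → ℂ) (v : ι → Fin n → ℂ[X])
    (z : ℂ) : evalVec (∑ k ∈ s, c k • v k) z = ∑ k ∈ s, c k • evalVec (v k) z := by
  ext b
  simp [evalVec, eval_finsetSum, Finset.sum_apply]

/-- The bilinear pairing `⟨v, w⟩ = ∑ b a, u_{b,a}(v_b w_a)`. -/
def pairing {q p : ℕ} (u : MatrixFunctional q p) (v : Fin q → ℂ[X]) (w : Fin p → ℂ[X]) : ℂ :=
  ∑ b, ∑ a, u b a (v b * w a)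

section Linear

variable {q p : ℕ} {u : MatrixFunctional q p} (hu : ∀ b a, IsLinearMap ℂ (u b a))
include hu

theorem pairing_sum_smul_left {ι : Type*} (s : Finset ι) (c : ι → ℂ) (v : ι → Fin q → ℂ[X])
    (w : Fin p → ℂ[X]) :
    pairing u (∑ k ∈ s, c k • v k) w = ∑ k ∈ s, c k * pairing u (v k) w := by
  have h : ∀ b a, u b a ((∑ k ∈ s, c k • v k) b * w a) = ∑ k ∈ s, c k * u b a (v k b * w a) := by
    intro b a
    have := map_sum (hu b a).mk' (fun k => c k • (v k b * w a)) s
    simp only [IsLinearMap.mk'_apply, (hu b a).map_smul, smul_eq_mul] at this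
    rw [← this, Finset.sum_apply, Finset.sum_mul]
    simp
  simp only [pairing, h, Finset.mul_sum]
  rw [Finset.sum_congr rfl fun b _ => Finset.sum_comm, Finset.sum_comm]

theorem pairing_sum_smul_right {ι : Type*} (s : Finset ι) (c : ι → ℂ) (v : Fin q → ℂ[X])
    (w : ι → Fin p → ℂ[X]) :
    pairing u v (∑ k ∈ s, c k • w k) = ∑ k ∈ s, c k * pairing u v (w k) := by
  have h : ∀ b a, u b a (v b * (∑ k ∈ s, c k • w k) a) = ∑ k ∈ s, c k * u b a (v b * w k a) := by
    intro b a
    have := map_sum (hu b a).mk' (fun k => c k • (v b * w k a)) s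
    simp only [IsLinearMap.mk'_apply, (hu b a).map_smul, smul_eq_mul] at this
    rw [← this, Finset.sum_apply, Finset.mul_sum]
    simp
  simp only [pairing, h, Finset.mul_sum]
  rw [Finset.sum_congr rfl fun b _ => Finset.sum_comm, Finset.sum_comm]

variable [NeZero q] [NeZero p]

theorem pairing_monomials (i j : ℕ) :
    pairing u (monomials q i) (monomials p j) = momentMatrix u i j := by
  have h0 : ∀ b a, u b a 0 = 0 := fun b a => (hu b a).map_zero
  rw [pairing, Finset.sum_eq_single (Fin.ofNat q i), Finset.sum_eq_single (Fin.ofNat p j)]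
  · simp only [monomials, if_true, momentMatrix, Matrix.of_apply]
  · intro a _ ha
    simp only [monomials, if_neg ha.symm, mul_zero, h0]
  · simp
  · intro b _ hb
    simp only [monomials, if_neg hb.symm, zero_mul, h0, Finset.sum_const_zero]
  · simp

/-- Triangularity of `SbarInv` yields orthogonality for `j < n`, and the nonzero value `H n` at `j =
n`. -/
theorem pairing_B_monomials (G : GaussBorel (momentMatrix u)) (n j : ℕ) :
    pairing u (G.B q n) (monomials p j) = G.H n * G.SbarInv j n := by
  rw [G.B_eq_sum n (Nat.lt_succ_self n), pairing_sum_smul_left hu]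
  simp_rw [pairing_monomials hu]
  exact G.sum_S_mul_moment n j

theorem pairing_B_monomials_of_lt (G : GaussBorel (momentMatrix u)) {n j : ℕ} (h : j < n) :
    pairing u (G.B q n) (monomials p j) = 0 := by
  rw [pairing_B_monomials hu, G.lower_SbarInv.2 j n h, mul_zero]

/-- `B_n` is orthogonal to all column vectors in the span of the first `n` monomials. -/
theorem pairing_B_eq_zero (G : GaussBorel (momentMatrix u)) {n : ℕ} (w : Fin p → ℂ[X])
    (hw : ∀ (a : Fin p) k, n ≤ p * k + a → (w a).coeff k = 0) :
    pairing u (G.B q n) w = 0 := by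
  rw [sum_monomials w n hw, pairing_sum_smul_right hu]
  refine Finset.sum_eq_zero fun m hm => ?_
  rw [pairing_B_monomials_of_lt hu G (Finset.mem_range.1 hm), mul_zero]

end Linear

/-! ### Integral representations -/

section Integral

variable {q p : ℕ} {m : Measure ℝ} {D : ℝ → Matrix (Fin q) (Fin p) ℂ}

theorem integrable_eval_mul {g : ℝ → ℂ} (h : ∀ k : ℕ, Integrable (fun x : ℝ => (x : ℂ) ^ k * g x) m)
    (f : ℂ[X]) : Integrable (fun x : ℝ => f.eval (x : ℂ) * g x) m := by
  have : (fun x : ℝ => f.eval (x : ℂ) * g x) = fun x : ℝ =>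
      ∑ k ∈ Finset.range (f.natDegree + 1), f.coeff k * ((x : ℂ) ^ k * g x) := by
    ext x
    rw [eval_eq_sum_range, Finset.sum_mul]
    exact Finset.sum_congr rfl fun k _ => by ring
  rw [this]
  exact integrable_finsetSum _ fun k _ => (h k).const_mul _

variable (h : ∀ (k : ℕ) b a, Integrable (fun x : ℝ => (x : ℂ) ^ k * D x b a) m)
include h

theorem isLinearMap_integral (b : Fin q) (a : Fin p) :
    IsLinearMap ℂ fun f : ℂ[X] => ∫ x : ℝ, f.eval (x : ℂ) * D x b a ∂m where
  map_add f g := by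
    simp_rw [eval_add, add_mul]
    exact integral_add (integrable_eval_mul (fun k => h k b a) f)
      (integrable_eval_mul (fun k => h k b a) g)
  map_smul c f := by
    simp_rw [eval_smul, smul_eq_mul, mul_assoc]
    exact integral_const_mul _ _

theorem sum_sum_integral (v : Fin q → ℂ[X]) (w : Fin p → ℂ[X]) :
    ∑ b, ∑ a, ∫ x : ℝ, (v b * w a).eval (x : ℂ) * D x b a ∂m =
      ∫ x : ℝ, evalVec v x ⬝ᵥ Matrix.mulVec (D x) (evalVec w x) ∂m := by
  have hi : ∀ b a, Integrable (fun x : ℝ => (v b * w a).eval (x : ℂ) * D x b a) m :=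
    fun b a => integrable_eval_mul (fun k => h k b a) _
  rw [Finset.sum_congr rfl fun b _ => (integral_finsetSum _ fun a _ => hi b a).symm,
    ← integral_finsetSum _ fun b _ => integrable_finsetSum _ fun a _ => hi b a]
  refine integral_congr_ae (Filter.Eventually.of_forall fun x => ?_)
  simp only [dotProduct, Matrix.mulVec, evalVec, Finset.mul_sum, eval_mul]
  exact Finset.sum_congr rfl fun b _ => Finset.sum_congr rfl fun a _ => by ring

end Integral

/-! ### The perturbed functional and its relation to `μ` -/

section Perturbation

variable {q p M : ℕ} {μ : MeasureMatrix q p}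

theorem HasMoments.isLinearMap (hμ : HasMoments μ) (b : Fin q) (a : Fin p) :
    IsLinearMap ℂ (μ.functional b a) := isLinearMap_integral hμ b a

theorem HasMoments.pairing_eq (hμ : HasMoments μ) (v : Fin q → ℂ[X]) (w : Fin p → ℂ[X]) :
    pairing μ.functional v w = ∫ x : ℝ, evalVec v x ⬝ᵥ
      Matrix.mulVec (density μ x) (evalVec w x) ∂(domMeasure μ) :=
  sum_sum_integral hμ v w

variable {L : Matrix (Fin q) (Fin q) ℂ[X]} {R : Matrix (Fin p) (Fin p) ℂ[X]}
  (hpert : PerturbationDefined μ L R) (ρ : Fin M → ℂ) (rl : Fin M → Fin p → ℂ)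
  (ξ : Fin M → ℂ → Fin q → ℂ)
include hpert

theorem PerturbationDefined.isLinearMap (b : Fin q) (a : Fin p) :
    IsLinearMap ℂ (uvarovFunctional μ L R ρ rl ξ b a) := by
  have h := isLinearMap_integral hpert.integrable b a
  constructor
  · intro f g
    have := h.map_add f g
    beta_reduce at this
    simp only [uvarovFunctional]
    rw [this]
    simp only [eval_add, add_mul, Finset.sum_add_distrib]
    ring
  · intro c f
    have := h.map_smul c f
    beta_reduce at this
    simp only [uvarovFunctional]
    rw [this]
    simp only [eval_smul, smul_eq_mul, mul_add, Finset.mul_sum, mul_assoc]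

theorem PerturbationDefined.pairing_eq (v : Fin q → ℂ[X]) (w : Fin p → ℂ[X]) :
    pairing (uvarovFunctional μ L R ρ rl ξ) v w =
      ∫ x : ℝ, evalVec v x ⬝ᵥ
        Matrix.mulVec (perturbedDensity μ L R x) (evalVec w x) ∂(domMeasure μ) +
      ∑ i, (Matrix.vecMul (evalVec v (ρ i)) (evalMat L (ρ i)) ⬝ᵥ ξ i (ρ i)) *
        (rl i ⬝ᵥ evalVec w (ρ i)) := by
  simp only [pairing, uvarovFunctional, Finset.sum_add_distrib]
  rw [sum_sum_integral hpert.integrable]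
  congr 1
  rw [Finset.sum_congr rfl fun b _ => Finset.sum_comm, Finset.sum_comm]
  refine Finset.sum_congr rfl fun i _ => ?_
  rw [← Matrix.dotProduct_mulVec, dotProduct, dotProduct, Finset.sum_mul_sum]
  refine Finset.sum_congr rfl fun b _ => Finset.sum_congr rfl fun a _ => ?_
  simp only [evalVec, eval_mul]
  ring

/-- Almost every `x` is not a zero of `det R`. -/
theorem PerturbationDefined.ae_det_ne_zero (hR : R.det ≠ 0) :
    ∀ᵐ x : ℝ ∂(domMeasure μ), (evalMat R (x : ℂ)).det ≠ 0 := by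
  have hdet : ∀ z, (evalMat R z).det = R.det.eval z := fun z => by
    have := RingHom.map_det (evalRingHom z) R
    simpa [evalMat, RingHom.mapMatrix_apply] using this.symm
  have hfin : {x : ℝ | R.det.IsRoot (x : ℂ)}.Finite :=
    (R.det.finite_setOfPred_isRoot hR).preimage Complex.ofReal_injective.injOn
  have hnull : domMeasure μ {x : ℝ | R.det.IsRoot (x : ℂ)} = 0 := by
    rw [← Set.biUnion_of_singleton {x : ℝ | R.det.IsRoot (x : ℂ)},
      measure_biUnion_null_iff hfin.countable]
    exact fun x hx => hpert.noAtom x hx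
  rw [ae_iff]
  simpa only [ne_eq, not_not, hdet, IsRoot.def] using hnull

/-- Off the null set of real zeros of `det R` the matrix inverse is genuine (elsewhere it is 0 by
convention). One null set serves all `v` and `w`, which may therefore depend on `x`. -/
theorem PerturbationDefined.ae_mulVec (hR : R.det ≠ 0) :
    ∀ᵐ x : ℝ ∂(domMeasure μ), ∀ (v : Fin q → ℂ) (w : Fin p → ℂ),
      v ⬝ᵥ Matrix.mulVec (perturbedDensity μ L R x) (Matrix.mulVec (evalMat R (x : ℂ)) w) =
        Matrix.vecMul v (evalMat L (x : ℂ)) ⬝ᵥ Matrix.mulVec (density μ x) w := by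
  filter_upwards [hpert.ae_det_ne_zero hR] with x hx v w
  rw [perturbedDensity, Matrix.mulVec_mulVec, Matrix.mul_assoc,
    Matrix.nonsing_inv_mul _ (isUnit_iff_ne_zero.2 hx), Matrix.mul_one, ← Matrix.mulVec_mulVec,
    Matrix.dotProduct_mulVec]

/-- `dμ̃ R = L dμ`. -/
theorem PerturbationDefined.pairing_mulVec (hR : R.det ≠ 0) (hμ : HasMoments μ)
    (hrl : ∀ i, IsLeftEigenvector R (ρ i) (rl i)) (v : Fin q → ℂ[X]) (w : Fin p → ℂ[X]) :
    pairing (uvarovFunctional μ L R ρ rl ξ) v (Matrix.mulVec R w) =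
      pairing μ.functional (Matrix.vecMul v L) w := by
  rw [hpert.pairing_eq, hμ.pairing_eq, Finset.sum_eq_zero, add_zero]
  · refine integral_congr_ae ?_
    filter_upwards [hpert.ae_mulVec hR] with x hx
    rw [evalVec_mulVec, evalVec_vecMul, hx]
  · intro i _
    rw [evalVec_mulVec, Matrix.dotProduct_mulVec, (hrl i).2, zero_dotProduct, mul_zero]

end Perturbation

/-- The Cauchy transforms `∫ v(x) dμ(x) r / (z - x)` converge for all polynomial row vectors `v`. -/
theorem CauchyDefined.integrable {q p : ℕ} {μ : MeasureMatrix q p} {z : ℂ} {r : Fin p → ℂ}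
    (h : CauchyDefined μ z r) (hμ : HasMoments μ) (hz : ∀ᵐ x : ℝ ∂(domMeasure μ), (x : ℂ) ≠ z)
    (v : Fin q → ℂ[X]) : Integrable (fun x : ℝ =>
      (evalVec v x ⬝ᵥ Matrix.mulVec (density μ x) r) / (z - x)) (domMeasure μ) := by
  have hm : ∀ (f : ℂ[X]) b, Integrable
      (fun x : ℝ => f.eval (x : ℂ) * Matrix.mulVec (density μ x) r b) (domMeasure μ) := by
    intro f b
    simp only [Matrix.mulVec, dotProduct, Finset.mul_sum, ← mul_assoc]
    exact integrable_finsetSum _ fun a _ =>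
      (integrable_eval_mul (fun k => hμ k b a) f).mul_const _
  simp only [dotProduct, Finset.sum_div]
  refine integrable_finsetSum _ fun b _ => ?_
  -- Write `v(x) = v(z) + (x - z) g(x)`: the first term is covered by the Cauchy hypothesis, the
  -- second by finite moments.
  have key := ((h b).const_mul ((v b).eval z)).sub (hm ((v b) /ₘ (X - C z)) b)
  refine key.congr ?_
  filter_upwards [hz] with x hx
  have hx' : z - x ≠ 0 := sub_ne_zero.2 hx.symm
  have e : (v b).eval (x : ℂ) = (v b).eval z + (x - z) * ((v b) /ₘ (X - C z)).eval (x : ℂ) := by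
    conv_lhs => rw [← modByMonic_add_div (v b) (X - C z), modByMonic_X_sub_C_eq_C_eval]
    simp
  simp only [Pi.sub_apply, evalVec, e]
  field_simp
  ring

/-! ### Eigenvector quotients -/

section EigenQuotient

variable {q p : ℕ} {μ : MeasureMatrix q p} {L : Matrix (Fin q) (Fin q) ℂ[X]}
  {R : Matrix (Fin p) (Fin p) ℂ[X]} {NR r MR : ℕ}

/-- The quotient `R(x) v / (x - z)` for an eigenvector `v` of `R` at `z`. -/
def eigenQuotient (R : Matrix (Fin p) (Fin p) ℂ[X]) (z : ℂ) (v : Fin p → ℂ) : Fin p → ℂ[X] :=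
  fun a => Matrix.mulVec R (fun b => C (v b)) a /ₘ (X - C z)

theorem X_sub_C_mul_eigenQuotient {z : ℂ} {v : Fin p → ℂ} (h : IsRightEigenvector R z v)
    (a : Fin p) : (X - C z) * eigenQuotient R z v a = Matrix.mulVec R (fun b => C (v b)) a := by
  refine mul_divByMonic_eq_iff_isRoot.2 ?_
  have := congrFun (evalVec_mulVec R (fun b => C (v b)) z) a
  have hv : evalVec (fun b => C (v b)) z = v := by ext b; simp [evalVec]
  rw [hv, h.2] at this
  exact this

theorem smul_evalVec_eigenQuotient {z : ℂ} {v : Fin p → ℂ} (h : IsRightEigenvector R z v)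
    (x : ℂ) : (x - z) • evalVec (eigenQuotient R z v) x = Matrix.mulVec (evalMat R x) v := by
  ext a
  have := congrArg (eval x) (X_sub_C_mul_eigenQuotient h a)
  have h2 := congrFun (evalVec_mulVec R (fun b => C (v b)) x) a
  have hv : evalVec (fun b => C (v b)) x = v := by ext b; simp [evalVec]
  rw [hv] at h2
  rw [← h2]
  simpa [evalVec] using this

/-- Differentiate `(x - z) Q(x) = R(x) v` at `z`. This is the source of `R'(ρ_i)` in `W`. -/
theorem evalVec_eigenQuotient_self {z : ℂ} {v : Fin p → ℂ} (h : IsRightEigenvector R z v) :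
    evalVec (eigenQuotient R z v) z = Matrix.mulVec (derivMat R z) v := by
  ext a
  have := congrArg (fun f => eval z (derivative f)) (X_sub_C_mul_eigenQuotient h a)
  simpa [evalVec, derivMat, Matrix.mulVec, dotProduct, eval_finsetSum, derivative_mul]
    using this

/-- The entries of `R v` have index below `p + M^R`, and division by `x - z` lowers the index by
`p`. -/
theorem RightNormalized.coeff_eigenQuotient (hR : RightNormalized R NR r) (hr : r < p)
    (hd : MR + r = p * NR) {z : ℂ} {v : Fin p → ℂ} (h : IsRightEigenvector R z v) (a : Fin p)
    (k : ℕ) (hk : MR ≤ p * k + a) : (eigenQuotient R z v a).coeff k = 0 := by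
  have hRv : ∀ k, MR ≤ p * k + a →
      (Matrix.mulVec R (fun b => C (v b)) a).coeff (k + 1) = 0 := by
    intro k hk
    simp only [Matrix.mulVec, dotProduct, finsetSum_coeff, coeff_mul_C]
    refine Finset.sum_eq_zero fun b _ => ?_
    have hb := b.2
    have := hR.transpose.coeff_eq_zero hr hd b a (k + 1) (by rw [mul_add]; omega)
    rw [Matrix.transpose_apply] at this
    rw [this, zero_mul]
  by_contra hne
  set f := eigenQuotient R z v a with hf
  have hf0 : f ≠ 0 := by rintro h0; simp [h0] at hne
  have hle : k ≤ f.natDegree := le_natDegree_of_ne_zero hne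
  -- At the top degree of the quotient the term with `z` drops out, so the vanishing coefficient of
  -- `R v` is the leading coefficient of the quotient.
  have h1 := hRv f.natDegree (hk.trans (by gcongr))
  rw [← X_sub_C_mul_eigenQuotient h a, ← hf, sub_mul, coeff_sub, coeff_X_mul, coeff_C_mul,
    coeff_eq_zero_of_natDegree_lt (Nat.lt_succ_self _), mul_zero, sub_zero] at h1
  exact hf0 (leadingCoeff_eq_zero.1 h1)

/-- In the integral `R` cancels `R⁻¹` and leaves `1 / (x - ρ_i)`, hence the minus sign. The mass at
`ρ_j`, `j ≠ i`, sees a multiple of `R(ρ_j) r_i`, which the left eigenvector kills; only the mass at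
`ρ_i` remains. -/
theorem pairing_eigenQuotient (hpert : PerturbationDefined μ L R)
    {ρ : Fin MR → ℂ} (hρ : SimpleSpectrum R ρ) {rl rr : Fin MR → Fin p → ℂ}
    (hrl : ∀ i, IsLeftEigenvector R (ρ i) (rl i)) (hrr : ∀ i, IsRightEigenvector R (ρ i) (rr i))
    (hz : ∀ i, ∀ᵐ x : ℝ ∂(domMeasure μ), (x : ℂ) ≠ ρ i)
    (ξ : Fin MR → ℂ → Fin q → ℂ) (v : Fin q → ℂ[X]) (i : Fin MR) :
    pairing (uvarovFunctional μ L R ρ rl ξ) v (eigenQuotient R (ρ i) (rr i)) =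
      -(∫ x : ℝ, (evalVec (Matrix.vecMul v L) x ⬝ᵥ Matrix.mulVec (density μ x) (rr i)) /
          (ρ i - x) ∂(domMeasure μ)) +
        (evalVec (Matrix.vecMul v L) (ρ i) ⬝ᵥ ξ i (ρ i)) *
          (rl i ⬝ᵥ Matrix.mulVec (derivMat R (ρ i)) (rr i)) := by
  rw [hpert.pairing_eq]
  congr 1
  · rw [← integral_neg]
    refine integral_congr_ae ?_
    filter_upwards [hpert.ae_mulVec hρ.regular, hz i] with x hx hxi
    have hne : (x : ℂ) - ρ i ≠ 0 := sub_ne_zero.2 hxi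
    have e : evalVec (eigenQuotient R (ρ i) (rr i)) x =
        ((x : ℂ) - ρ i)⁻¹ • Matrix.mulVec (evalMat R x) (rr i) := by
      rw [← smul_evalVec_eigenQuotient (hrr i), smul_smul, inv_mul_cancel₀ hne, one_smul]
    rw [e, Matrix.mulVec_smul, dotProduct_smul, hx, evalVec_vecMul, ← neg_sub, inv_neg, neg_smul,
      smul_eq_mul, div_eq_inv_mul]
  · rw [Finset.sum_eq_single i]
    · rw [evalVec_eigenQuotient_self (hrr i), evalVec_vecMul]
    · intro j _ hj
      have hne : ρ j - ρ i ≠ 0 := sub_ne_zero.2 fun h => hj (hρ.injective h)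
      have e : evalVec (eigenQuotient R (ρ i) (rr i)) (ρ j) =
          (ρ j - ρ i)⁻¹ • Matrix.mulVec (evalMat R (ρ j)) (rr i) := by
        rw [← smul_evalVec_eigenQuotient (hrr i), smul_smul, inv_mul_cancel₀ hne, one_smul]
      rw [e, dotProduct_smul, Matrix.dotProduct_mulVec, (hrl j).2, zero_dotProduct, smul_zero,
        mul_zero]
    · simp

end EigenQuotient

/-! ### The connection matrix of the perturbation -/

section Main

variable {q p : ℕ} [NeZero p] [NeZero q] {μ : MeasureMatrix q p}
  {L : Matrix (Fin q) (Fin q) ℂ[X]} {R : Matrix (Fin p) (Fin p) ℂ[X]}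
  {NR r NL l MR ML : ℕ}

theorem RightNormalized.mulVec_monomials_eq_sum (hR : RightNormalized R NR r) (hr : r < p)
    (hd : MR + r = p * NR) (j : ℕ) : Matrix.mulVec R (monomials p j) =
      ∑ m ∈ Finset.range (j + MR + 1), polyShift R.transpose j m • monomials p m := by
  rw [← hR.transpose.vecMul_monomials_eq_sum hr hd j (Nat.lt_succ_self _), Matrix.vecMul_transpose]

/-- Pairing `B̃_n L = ∑ Ω_{n,j} B_j` with the `k`-th monomial gives 0, since `R` raises the index by
at most `M^R`. Orthogonality removes `j > k` and induction removes `j < k`, leaving `Ω_{n,k} H_k =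
0`. -/
theorem connectionMatrix_eq_zero_of_add_lt (hμ : HasMoments μ) (hr : r < p) (hl : l < q)
    (hR : RightNormalized R NR r) (hL : LeftNormalized L NL l)
    (hRd : MR + r = p * NR) (hLd : ML + l = q * NL) (hdet : R.det ≠ 0)
    {ρ : Fin MR → ℂ} {rl : Fin MR → Fin p → ℂ}
    (hrl : ∀ i, IsLeftEigenvector R (ρ i) (rl i)) {ξ : Fin MR → ℂ → Fin q → ℂ}
    (hpert : PerturbationDefined μ L R)
    (G : GaussBorel (momentMatrix μ.functional))
    (Gt : GaussBorel (momentMatrix (uvarovFunctional μ L R ρ rl ξ))) {n : ℕ} (k : ℕ)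
    (hk : k + MR < n) : connectionMatrix G Gt L n k = 0 := by
  induction k using Nat.strong_induction_on with
  | _ k ih =>
    have h1 : pairing μ.functional (Matrix.vecMul (Gt.B q n) L) (monomials p k) = 0 := by
      rw [← hpert.pairing_mulVec ρ rl ξ hdet hμ hrl, hR.mulVec_monomials_eq_sum hr hRd,
        pairing_sum_smul_right (hpert.isLinearMap ρ rl ξ)]
      refine Finset.sum_eq_zero fun m hm => ?_
      rw [pairing_B_monomials_of_lt (hpert.isLinearMap ρ rl ξ) Gt (by simp at hm; omega), mul_zero]
    rw [hL.vecMul_B G Gt hl hLd, pairing_sum_smul_left hμ.isLinearMap,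
      Finset.sum_eq_single_of_mem k (by simp; omega), pairing_B_monomials hμ.isLinearMap,
      G.lower_SbarInv.1, mul_one] at h1
    · exact (mul_eq_zero.1 h1).resolve_right (G.H_ne_zero k)
    · intro j _ hj
      rcases lt_or_gt_of_ne hj with hj | hj
      · rw [ih j hj (by omega), zero_mul]
      · rw [pairing_B_monomials_of_lt hμ.isLinearMap G hj, mul_zero]

end Main

end UvarovMOP

end

/-! ### The band structure and the linear system -/

theorem mainTheorem7 {p q : ℕ} [NeZero p] [NeZero q]
    (μ : UvarovMOP.MeasureMatrix q p) (hμ : UvarovMOP.HasMoments μ)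
    {NR r NL l MR ML : ℕ} (hr : r < p) (hl : l < q)
    (R : Matrix (Fin p) (Fin p) ℂ[X]) (L : Matrix (Fin q) (Fin q) ℂ[X])
    (hR : UvarovMOP.RightNormalized R NR r) (hL : UvarovMOP.LeftNormalized L NL l)
    (ρ : Fin MR → ℂ) (hρ : UvarovMOP.SimpleSpectrum R ρ)
    (lam : Fin ML → ℂ) (hlam : UvarovMOP.SimpleSpectrum L lam)
    (rl rr : Fin MR → Fin p → ℂ) (lr : Fin ML → Fin q → ℂ)
    (hrl : ∀ i, UvarovMOP.IsLeftEigenvector R (ρ i) (rl i))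
    (hrr : ∀ i, UvarovMOP.IsRightEigenvector R (ρ i) (rr i))
    (hlr : ∀ j, UvarovMOP.IsRightEigenvector L (lam j) (lr j))
    (ξ : Fin MR → ℂ → Fin q → ℂ)
    (hpert : UvarovMOP.PerturbationDefined μ L R)
    (hD : ∀ i, UvarovMOP.CauchyDefined μ (ρ i) (rr i))
    (G : UvarovMOP.GaussBorel (UvarovMOP.momentMatrix μ.functional))
    (Gt : UvarovMOP.GaussBorel
      (UvarovMOP.momentMatrix (UvarovMOP.uvarovFunctional μ L R ρ rl ξ)))
    (n : ℕ) (hn : MR ≤ n) :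
    (∀ k, UvarovMOP.connectionMatrix G Gt L n k ≠ 0 → n - MR ≤ k ∧ k ≤ n + ML) ∧
    UvarovMOP.connectionMatrix G Gt L n (n + ML) = 1 ∧
    Matrix.vecMul
        (fun j : Fin (MR + ML) => UvarovMOP.connectionMatrix G Gt L n (n - MR + j))
        (Matrix.of fun j : Fin (MR + ML) =>
          UvarovMOP.systemRow μ G R lam lr ρ rl rr ξ (n - MR + j)) =
      - UvarovMOP.systemRow μ G R lam lr ρ rl rr ξ (n + ML) := by
  open UvarovMOP in
  have hLd : ML + l = q * NL := hL.add_eq_mul hl hlam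
  have hρT : SimpleSpectrum R.transpose ρ := by
    obtain ⟨h1, h2, h3, h4⟩ := hρ
    exact ⟨by rwa [Matrix.det_transpose], h2, by rwa [Matrix.det_transpose],
      by rwa [Matrix.det_transpose]⟩
  have hRd : MR + r = p * NR := hR.transpose.add_eq_mul hr hρT
  have hlow : ∀ k, k + MR < n → connectionMatrix G Gt L n k = 0 := fun k hk =>
    connectionMatrix_eq_zero_of_add_lt hμ hr hl hR hL hRd hLd hρ.regular hrl hpert G Gt k hk
  have hone := hL.connectionMatrix_eq_one G Gt hl hLd n
  have hB := hL.vecMul_B G Gt hl hLd n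
  refine ⟨fun k hk => ⟨?_, ?_⟩, hone, ?_⟩
  · by_contra h
    exact hk (hlow k (by omega))
  · by_contra h
    exact hk (hL.connectionMatrix_eq_zero G Gt hl hLd (by omega))
  have hev : ∀ z, ∑ k ∈ Finset.range (n + ML + 1), connectionMatrix G Gt L n k • G.evalB q k z =
      Matrix.vecMul (evalVec (Gt.B q n) z) (evalMat L z) := fun z => by
    rw [← evalVec_vecMul, hB, evalVec_sum_smul]
    rfl
  have hz : ∀ i, ∀ᵐ x : ℝ ∂(domMeasure μ), (x : ℂ) ≠ ρ i := fun i => by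
    filter_upwards [hpert.ae_det_ne_zero hρ.regular] with x hx h
    rw [h] at hx
    exact hx (Matrix.exists_mulVec_eq_zero_iff.1 ⟨rr i, hrr i⟩)
  -- Both families of equations are first proved for the whole row; the columns left of the band are
  -- discarded at the end.
  have total : ∑ k ∈ Finset.range (n + ML + 1),
      connectionMatrix G Gt L n k • systemRow μ G R lam lr ρ rl rr ξ k = 0 := by
    funext s
    rw [Finset.sum_apply, Pi.zero_apply]
    rcases s with j | i
    · have h := congrArg (· ⬝ᵥ lr j) (hev (lam j))
      simp only [sum_dotProduct, smul_dotProduct] at h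
      rw [← Matrix.dotProduct_mulVec, (hlr j).2, dotProduct_zero] at h
      exact h
    · have hzero : pairing (uvarovFunctional μ L R ρ rl ξ) (Gt.B q n)
          (eigenQuotient R (ρ i) (rr i)) = 0 :=
        -- Here `n ≥ M^R` is essential: the quotient lies in the span of the first `M^R` monomials.
        pairing_B_eq_zero (hpert.isLinearMap ρ rl ξ) Gt _ fun a k hk =>
          hR.coeff_eigenQuotient hr hRd (hrr i) a k (hn.trans hk)
      rw [pairing_eigenQuotient hpert hρ hrl hrr hz ξ] at hzero
      have hint : ∫ x : ℝ, (evalVec (Matrix.vecMul (Gt.B q n) L) x ⬝ᵥ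
            Matrix.mulVec (density μ x) (rr i)) / (ρ i - x) ∂(domMeasure μ) =
          ∑ k ∈ Finset.range (n + ML + 1),
            connectionMatrix G Gt L n k * cauchyDApply μ G k (ρ i) (rr i) := by
        simp only [cauchyDApply, ← integral_const_mul]
        refine Eq.trans (integral_congr_ae (Filter.Eventually.of_forall fun x => ?_))
          (integral_finsetSum _ fun k _ =>
            ((hD i).integrable hμ (hz i) (G.B q k)).const_mul _)
        simp only [hB, evalVec_sum_smul, sum_dotProduct, smul_dotProduct, Finset.sum_div,
          smul_eq_mul, mul_div_assoc]
        rfl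
      rw [hint, evalVec_vecMul, ← hev, sum_dotProduct, Finset.sum_mul, neg_add_eq_zero] at hzero
      simp only [Pi.smul_apply, systemRow, Sum.elim_inr, smul_eq_mul, mul_sub,
        Finset.sum_sub_distrib]
      rw [hzero, sub_eq_zero]
      exact Finset.sum_congr rfl fun k _ => by rw [smul_dotProduct, smul_eq_mul, mul_assoc]
  rw [Finset.sum_range_succ, hone, one_smul] at total
  rw [eq_neg_iff_add_eq_zero, ← total]
  congr 1
  have hvm : ∀ (c : Fin (MR + ML) → ℂ) (A : Matrix (Fin (MR + ML)) (Fin ML ⊕ Fin MR) ℂ),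
      Matrix.vecMul c A = ∑ j, c j • A j := fun c A => by
    ext s
    simp [Matrix.vecMul, dotProduct]
  rw [hvm]
  have hsplit : n + ML = (n - MR) + (MR + ML) := by omega
  have hhead : ∑ k ∈ Finset.range (n - MR),
      connectionMatrix G Gt L n k • systemRow μ G R lam lr ρ rl rr ξ k = 0 :=
    Finset.sum_eq_zero fun k hk => by rw [hlow k (by simp at hk; omega), zero_smul]
  rw [hsplit, Finset.sum_range_add, hhead, zero_add, Finset.sum_range]
  rfl
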